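/- All alphabets are finite, and $\varepsilon$ denotes the empty word. A \emph{transducer} $T$ over an alphabet $\Gamma$ is a finite automaton, with one initial state, a set of final states, and transitions $p \xrightarrow{x/y} q$ labelled by pairs $(x,y) \in (\Gamma\cup\{\varepsilon\})\times(\Gamma\cup\{\varepsilon\})$; it accepts the pairs of words $(u,v)\in\Gamma^*\times\Gamma^*$ obtained by multiplying componentwise the labels of a run from the initial state to a final state. It is \emph{synchronous} if all its labels lie in $\Gamma\times\Gamma$, and \emph{sequential} if, whenever $q \xrightarrow{x/y} q'$ and $q \xrightarrow{x'/y'} q''$, either $x=x'$, $y=y'$ and $q'=q''$, or $x\ne\varepsilon$, $x'\ne\varepsilon$ and $x\ne x'$. A \emph{rational graph} $G$ labelled by $\Sigma$ with vertices in $\Gamma^*$ is given by a family $(T_a)_{a\in\Sigma}$ of transducers over $\Gamma$: there is an edge $u\xrightarrow{a}v$ if and only if $T_a$ accepts $(u,v)$. It is \emph{sequential synchronous} if every $T_a$ is both sequential and synchronous. For $I,F\subseteq\Gamma^*$, the language accepted by $G$ between $I$ and $F$ is \[ L(G,I,F)=\{\,w\in\Sigma^* \mid s\xrightarrow{w}t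 \text{ for some } s\in I,\ t\in F\,\}, \] where $s\xrightarrow{w}t$ means that there is a path from $s$ to $t$ labelled by $w$ (for $w=\varepsilon$: $s=t$). A language over $\Sigma$ is \emph{context-sensitive} if it is accepted by a linearly bounded machine, i.e. a nondeterministic one-tape Turing machine that starts on its input written between two endmarkers, never leaves the part of the tape delimited by the endmarkers and never overwrites them, and accepts by reaching an accepting state. (The empty word is allowed to belong to a context-sensitive language.) \textbf{Proposition.} The languages accepted by sequential synchronous rational graphs between rational sets of initial and final vertices are exactly the context-sensitive languages: for every finite alphabet $\Sigma$, a language $L\subseteq\Sigma^*$ is context-sensitive if and only if there are a finite alphabet $\Gamma$, a sequential synchronous rational graph $G$ labelled by $\Sigma$ with vertices in $\Gamma^*$, and rational languages $I,F\subseteq\Gamma^*$ such that $L=L(G,I,F)$. -/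

import Mathlib

/-- A transducer over the alphabet `Γ`: a finite automaton over the product monoid `Γ* × Γ*` whose
labels are pairs in `(Γ ∪ {ε}) × (Γ ∪ {ε})`. The empty word `ε` is represented by `none`;
`trans p x y q` says that there is a transition from `p` to `q` with label `x/y`. -/
structure Transducer (Γ : Type) where
  State : Type
  finite_state : Finite State
  start : State
  accept : Set State
  trans : State → Option Γ → Option Γ → State → Prop

namespace Transducer

variable {Γ : Type}

/-- `T.Run p u v q`: some run of `T` leads from `p` to `q` and is associated to the pair `(u, v)`,
the product of the labels of its transitions. -/
inductive Run (T : Transducer Γ) : T.State → List Γ → List Γ → T.State → Prop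
  | nil (p : T.State) : Run T p [] [] p
  | cons {p r q : T.State} {x y : Option Γ} {u v : List Γ} :
      T.trans p x y r → Run T r u v q → Run T p (x.toList ++ u) (y.toList ++ v) q

/-- The relation on words accepted by a transducer. -/
def Accepts (T : Transducer Γ) (u v : List Γ) : Prop :=
  ∃ q ∈ T.accept, T.Run T.start u v q

/-- A transducer is synchronous if all its labels belong to `Γ × Γ`. -/
def IsSynchronous (T : Transducer Γ) : Prop :=
  ∀ p x y q, T.trans p x y q → x ≠ none ∧ y ≠ none

/-- A transducer is sequential if any two transitions leaving the same state are either equal or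
have distinct inputs which are both different from `ε`. -/
def IsSequential (T : Transducer Γ) : Prop :=
  ∀ q x y q' x' y' q'', T.trans q x y q' → T.trans q x' y' q'' →
    (x = x' ∧ y = y' ∧ q' = q'') ∨ (x ≠ none ∧ x' ≠ none ∧ x ≠ x')

end Transducer

/-- A rational graph labelled by `A` with vertices in `Γ*`: one transducer over `Γ` for every
label. -/
structure RationalGraph (A Γ : Type) where
  transducer : A → Transducer Γ

namespace RationalGraph

variable {A Γ : Type}

/-- There is an edge labelled by `a` from `u` to `v` iff the transducer of `a` accepts `(u, v)`. -/
def Edge (G : RationalGraph A Γ) (u : List Γ) (a : A) (v : List Γ) : Prop :=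
  (G.transducer a).Accepts u v

/-- `G.Path s w t`: there is a path labelled by `w` from the vertex `s` to the vertex `t`. -/
inductive Path (G : RationalGraph A Γ) : List Γ → List A → List Γ → Prop
  | nil (s : List Γ) : Path G s [] s
  | cons {s r t : List Γ} {a : A} {w : List A} :
      G.Edge s a r → Path G r w t → Path G s (a :: w) t

/-- The path language `L(G, I, F)` of `G` between the sets of vertices `I` and `F`. -/
def pathLanguage (G : RationalGraph A Γ) (I F : Language Γ) : Language A :=
  {w | ∃ s ∈ I, ∃ t ∈ F, G.Path s w t}

/-- A rational graph is synchronous if all its transducers are. -/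
def IsSynchronous (G : RationalGraph A Γ) : Prop :=
  ∀ a, (G.transducer a).IsSynchronous

/-- A rational graph is sequential if all its transducers are. -/
def IsSequential (G : RationalGraph A Γ) : Prop :=
  ∀ a, (G.transducer a).IsSequential

end RationalGraph

/-- The content of a tape cell of a linearly bounded machine: one of the two endmarkers, or a
symbol of the tape alphabet. -/
inductive TapeCell (S : Type) where
  | leftEnd : TapeCell S
  | sym : S → TapeCell S
  | rightEnd : TapeCell S

/-- The direction of a move of the head. -/
inductive HeadMove where
  | left : HeadMove
  | right : HeadMove

/-- A (nondeterministic) linearly bounded machine with input alphabet `A`: a one-tape Turing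
machine whose input is written between two endmarkers, which never leaves the part of the tape
delimited by the endmarkers and never prints over an endmarker, nor an endmarker over another
symbol. `trans p c q d m` says that in state `p`, reading `c`, the machine may enter state `q`,
write `d` and move its head in direction `m`. -/
structure LinearlyBoundedMachine (A : Type) where
  State : Type
  finite_state : Finite State
  Symbol : Type
  finite_symbol : Finite Symbol
  input : A ↪ Symbol
  start : State
  accept : Set State
  trans : State → TapeCell Symbol → State → TapeCell Symbol → HeadMove → Prop
  trans_leftEnd : ∀ p q d m, trans p TapeCell.leftEnd q d m →
    d = TapeCell.leftEnd ∧ m = HeadMove.right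
  trans_rightEnd : ∀ p q d m, trans p TapeCell.rightEnd q d m →
    d = TapeCell.rightEnd ∧ m = HeadMove.left
  trans_sym : ∀ p s q d m, trans p (TapeCell.sym s) q d m → ∃ s', d = TapeCell.sym s'

namespace LinearlyBoundedMachine

variable {A : Type}

/-- The configurations of a linearly bounded machine on an input of length `n`: the tape has
`n + 2` cells, two of which hold the endmarkers. -/
structure Config (M : LinearlyBoundedMachine A) (n : ℕ) where
  state : M.State
  head : Fin (n + 2)
  tape : Fin (n + 2) → TapeCell M.Symbol

/-- The position `j` results from the position `i` by a move in the given direction. -/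
def Moves {n : ℕ} (i : Fin (n + 2)) : HeadMove → Fin (n + 2) → Prop
  | HeadMove.left, j => (j : ℕ) + 1 = i
  | HeadMove.right, j => (j : ℕ) = i + 1

/-- One step of computation. -/
def Step (M : LinearlyBoundedMachine A) {n : ℕ} (c c' : M.Config n) : Prop :=
  ∃ d m, M.trans c.state (c.tape c.head) c'.state d m ∧
    Moves c.head m c'.head ∧ c'.tape = Function.update c.tape c.head d

/-- The initial tape for the input `w`: left endmarker, the letters of `w`, right endmarker. -/
def initTape (M : LinearlyBoundedMachine A) (w : List A) (i : Fin (w.length + 2)) :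
    TapeCell M.Symbol :=
  if i.val = 0 then TapeCell.leftEnd
  else if h : i.val - 1 < w.length then TapeCell.sym (M.input w[i.val - 1])
  else TapeCell.rightEnd

/-- The initial configuration on the input `w`: the head is on the left endmarker. -/
def init (M : LinearlyBoundedMachine A) (w : List A) : M.Config w.length where
  state := M.start
  head := 0
  tape := M.initTape w

/-- The language of a linearly bounded machine: the inputs on which some computation reaches an
accepting state. -/
def language (M : LinearlyBoundedMachine A) : Language A :=
  {w | ∃ c : M.Config w.length, Relation.ReflTransGen M.Step (M.init w) c ∧ c.state ∈ M.accept}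

end LinearlyBoundedMachine

/-- A language is context-sensitive if it is accepted by a linearly bounded machine. -/
def IsContextSensitive {A : Type} (L : Language A) : Prop :=
  ∃ M : LinearlyBoundedMachine A, M.language = L

/-! From machines to graphs, the path label becomes the initial content of a queue. Put the n + 2
tape cells of a machine on a circle, marking the cell under the head with the state. Two
neighbouring cells lie in a window and the other n form a queue. A round rewrites the window by at
most one machine step, pushes one of its cells into the queue and pops the next one, so that the
window travels around the circle. A one-letter delay is computed by a sequential synchronous
transducer, and a path labelled by w composes |w| delays, which is a queue initially holding w
(`delays_cons`). Start vertices guess the pushed cells, in two copies. The path delays the second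
copy, so the final vertex lists the pairs (pushed cell, popped cell), and a finite automaton
carrying only the window checks them. The window loses nothing: acceptance does not depend on its
position (`WindowAccepts.all`), and machine steps and window rewritings correspond.

From graphs to machines, the vertices along a path of a synchronous graph have equal length and form
a rectangular array. The machine reads it column by column: cell j stores the j-th label with the
current state of its transducer. Each left-to-right sweep guesses a letter of the initial vertex,
passes it through all transducers, and obtains a letter of the final vertex. Automata for I and F
run in the finite control. `Cascade` describes the array by rows, `Column` its first column, and
`Cascade.exists_column` and `Column.cascade` exchange the two views. -/

namespace RationalGraph

/-! ### Delays and queues -/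

/-- The map on words that replaces the second component of every letter by that of the previous
letter, the first one being replaced by `c`. -/
def delay {X Y : Type} : Y → List (X × Y) → List (X × Y)
  | _, [] => []
  | c, (x, y) :: u => (x, c) :: delay y u

/-- The transducer that computes `delay c`. -/
def delayTransducer (X : Type) {Y : Type} [Finite Y] (c : Y) : Transducer (X × Y) where
  State := Y
  finite_state := inferInstance
  start := c
  accept := Set.univ
  trans p a b q := ∃ x y, a = some (x, y) ∧ b = some (x, p) ∧ q = y

theorem run_delayTransducer {X Y : Type} [Finite Y] {c : Y}
    {p q : (delayTransducer X c).State} {u v : List (X × Y)}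
    (h : (delayTransducer X c).Run p u v q) : v = delay (Y := Y) p u := by
  induction h with
  | nil p => rfl
  | cons ht _ ih =>
    obtain ⟨x, y, rfl, rfl, rfl⟩ := ht
    simp [delay, ih]

theorem exists_run_delayTransducer {X Y : Type} [Finite Y] (c p : Y) (u : List (X × Y)) :
    ∃ q : Y, (delayTransducer X c).Run p u (delay p u) q := by
  induction u generalizing p with
  | nil => exact ⟨p, .nil (T := delayTransducer X c) p⟩
  | cons a u ih =>
    obtain ⟨x, y⟩ := a
    obtain ⟨q, hq⟩ := ih y
    exact ⟨q, .cons (x := some (x, y)) (y := some (x, p)) ⟨x, y, rfl, rfl, rfl⟩ hq⟩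

theorem accepts_delayTransducer {X Y : Type} [Finite Y] {c : Y} {u v : List (X × Y)} :
    (delayTransducer X c).Accepts u v ↔ v = delay c u := by
  constructor
  · rintro ⟨q, -, h⟩
    exact run_delayTransducer h
  · rintro rfl
    obtain ⟨q, hq⟩ := exists_run_delayTransducer c c u
    exact ⟨q, trivial, hq⟩

/-- The graph whose edges labelled by `a` are given by `delay (f a)`. -/
def delayGraph {A : Type} (X : Type) {Y : Type} [Finite Y] (f : A → Y) :
    RationalGraph A (X × Y) where
  transducer a := delayTransducer X (f a)

theorem isSequential_delayGraph {A X Y : Type} [Finite Y] (f : A → Y) :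
    (delayGraph X f).IsSequential := by
  rintro a q _ _ _ _ _ _ ⟨x, y, rfl, rfl, hy⟩ ⟨x', y', rfl, rfl, hy'⟩
  by_cases h : (x, y) = (x', y')
  · left
    cases h
    exact ⟨rfl, rfl, hy.trans hy'.symm⟩
  · right
    simpa using h

theorem isSynchronous_delayGraph {A X Y : Type} [Finite Y] (f : A → Y) :
    (delayGraph X f).IsSynchronous := by
  rintro a q _ _ _ ⟨x, y, rfl, rfl, -⟩
  simp

/-- The composition of the maps `delay c`, for the letters `c` of a word. -/
def delays {X Y : Type} (C : List Y) (u : List (X × Y)) : List (X × Y) :=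
  C.foldl (fun u c => delay c u) u

theorem path_delayGraph {A X Y : Type} [Finite Y] {f : A → Y} {w : List A}
    {s t : List (X × Y)} : (delayGraph X f).Path s w t ↔ t = delays (w.map f) s := by
  induction w generalizing s with
  | nil =>
    constructor
    · rintro ⟨⟩
      rfl
    · rintro rfl
      exact .nil _
  | cons a w ih =>
    constructor
    · rintro (_ | ⟨he, hp⟩)
      rw [ih.1 hp, accepts_delayTransducer.1 he]
      rfl
    · rintro rfl
      exact .cons (accepts_delayTransducer.2 rfl) (ih.2 rfl)

theorem delays_nil {X Y : Type} (C : List Y) : delays C ([] : List (X × Y)) = [] := by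
  induction C with
  | nil => rfl
  | cons c C ih => exact ih

/-- A composition of delays is a first-in-first-out queue with its oldest entry last: y enters in
front, z leaves at the end, and `C'` is the queue left for the rest of the word. -/
theorem delays_cons {X Y : Type} {C C' : List Y} {x : X} {y z : Y} (u : List (X × Y))
    (h : y :: C = C' ++ [z]) : delays C ((x, y) :: u) = (x, z) :: delays C' u := by
  induction C generalizing C' y u with
  | nil =>
    cases C' with
    | nil =>
      obtain rfl : y = z := by simpa using h
      rfl
    | cons c C' => simp at h
  | cons c C ih =>
    cases C' with
    | nil => simp at h
    | cons c' C' =>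
      simp only [List.cons_append, List.cons.injEq] at h
      obtain ⟨rfl, h⟩ := h
      exact ih (delay y u) h

end RationalGraph

/-! ### The window automaton -/

instance {S : Type} [Finite S] : Finite (TapeCell S) := by
  refine Finite.of_injective
    (β := Option (Option S))
    (fun | .leftEnd => none | .rightEnd => some none | .sym s => some (some s)) ?_
  rintro (_ | s | _) (_ | t | _) <;> simp

namespace LinearlyBoundedMachine

variable {A : Type} (M : LinearlyBoundedMachine A)

/-- A tape cell together with the state of the machine if its head is on this cell. -/
abbrev MarkedCell : Type := TapeCell M.Symbol × Option M.State

instance : Finite M.MarkedCell :=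
  have := M.finite_symbol
  have := M.finite_state
  inferInstance

/-- `M.WindowStep a b a' b'`: if the content of two neighbouring cells is `b` and `a`, from left to
right, then it may become `b'` and `a'` in at most one step. -/
inductive WindowStep : M.MarkedCell → M.MarkedCell → M.MarkedCell → M.MarkedCell → Prop
  | stay (a b) : WindowStep a b a b
  | left {p q c d e} : M.trans p c q d .left →
      WindowStep (c, some p) (e, none) (d, none) (e, some q)
  | right {p q c d e} : M.trans p c q d .right →
      WindowStep (e, none) (c, some p) (e, some q) (d, none)

/-- The automaton that has a window of two cells of a cyclic tape in its memory, rewrites them,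
moves one of them to a queue, and receives a cell from this queue. -/
def windowNFA : NFA (M.MarkedCell × M.MarkedCell) (M.MarkedCell × M.MarkedCell) where
  step h x := {g | M.WindowStep h.1 h.2 x.1 g.1 ∧ g.2 = x.2}
  start := {((.leftEnd, some M.start), (.rightEnd, none))}
  accept := {h | ∃ q ∈ M.accept, h.1.2 = some q}

theorem cons_mem_acceptsFrom_windowNFA {a b x z : M.MarkedCell}
    {u : List (M.MarkedCell × M.MarkedCell)} :
    (x, z) :: u ∈ M.windowNFA.acceptsFrom {(a, b)} ↔
      ∃ y, M.WindowStep a b x y ∧ u ∈ M.windowNFA.acceptsFrom {(y, z)} := by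
  rw [NFA.cons_mem_acceptsFrom, NFA.stepSet_singleton, NFA.mem_acceptsFrom]
  constructor
  · rintro ⟨s, hs, h⟩
    obtain ⟨⟨y, z'⟩, ⟨hy, hz⟩, h'⟩ := NFA.mem_evalFrom_iff_exists.1 h
    dsimp only at hz
    subst hz
    exact ⟨y, hy, s, hs, h'⟩
  · rintro ⟨y, hy, s, hs, h⟩
    exact ⟨s, hs, NFA.mem_evalFrom_iff_exists.2 ⟨(y, z), ⟨hy, rfl⟩, h⟩⟩

/-- The automaton that accepts the words over `X × X` with two equal components. -/
def _root_.NFA.diagonal (X : Type) : NFA (X × X) Unit where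
  step _ x := {_g | x.1 = x.2}
  start := Set.univ
  accept := Set.univ

theorem _root_.NFA.mem_acceptsFrom_diagonal {X : Type} {u : List (X × X)} {S : Set Unit} :
    u ∈ (NFA.diagonal X).acceptsFrom S ↔ S.Nonempty ∧ ∃ v : List X, u = v.map fun x => (x, x) := by
  induction u generalizing S with
  | nil => simp [NFA.diagonal, Set.Nonempty]
  | cons a u ih =>
    obtain ⟨x, y⟩ := a
    rw [NFA.cons_mem_acceptsFrom, ih]
    constructor
    · rintro ⟨⟨s, h⟩, v, rfl⟩
      obtain ⟨t, ht, h⟩ := NFA.mem_stepSet.1 h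
      obtain rfl : x = y := h
      exact ⟨⟨t, ht⟩, x :: v, rfl⟩
    · rintro ⟨⟨s, hs⟩, v, h⟩
      cases v with
      | nil => simp at h
      | cons b v =>
        simp only [List.map_cons, List.cons.injEq, Prod.mk.injEq] at h
        obtain ⟨⟨rfl, rfl⟩, rfl⟩ := h
        exact ⟨⟨(), NFA.mem_stepSet.2 ⟨s, hs, rfl⟩⟩, v, rfl⟩

theorem _root_.NFA.isRegular_accepts {X σ : Type} [Finite σ] (N : NFA X σ) :
    N.accepts.IsRegular := by
  classical
  have := Fintype.ofFinite σ
  exact ⟨Set σ, inferInstance, N.toDFA, N.toDFA_correct⟩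

/-! ### Configurations as cyclic tapes -/

variable {M} {n : ℕ}

/-- The tape of a configuration, with the position of the head marked by the state. -/
def Config.marked (c : M.Config n) (i : Fin (n + 2)) : M.MarkedCell :=
  (c.tape i, if i = c.head then some c.state else none)

theorem _root_.Fin.one_add_castSucc_castSucc (i : Fin n) :
    (1 : Fin (n + 2)) + i.castSucc.castSucc = i.succ.castSucc :=
  (add_comm _ _).trans (Fin.ext (by simp))

/-- The word read along a cycle from the position after `k` to the position before `k - 1`. -/
def cyclicWord {X : Type} (e : Fin (n + 2) → X) (k : Fin (n + 2)) : List X :=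
  List.ofFn fun i : Fin n => e (k + 1 + i.castSucc.castSucc)

/-- The window on k, k - 1 moves to k - 1, k - 2: the new content of cell k is pushed and cell k - 2
is popped. For n = 0 these are the same cell, so the popped value must be read from the updated tape
`e'`. -/
theorem cons_cyclicWord {X : Type} (e : Fin (n + 2) → X) (k : Fin (n + 2)) (x y : X) :
    let e' := Function.update (Function.update e k x) (k - 1) y
    x :: cyclicWord e k = cyclicWord e' (k - 1) ++ [e' (k - 1 - 1)] := by
  intro e'
  have hlast : ((Fin.last n).castSucc : Fin (n + 2)) + 1 = Fin.last (n + 1) := by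
    ext; simp
  have hneg : (Fin.last (n + 1) : Fin (n + 2)) = -1 := by
    rw [eq_neg_iff_add_eq_zero, Fin.last_add_one]
  have h1 : x :: cyclicWord e k = List.ofFn fun i : Fin (n + 1) => e' (k + i.castSucc) := by
    rw [List.ofFn_succ]
    congr 1
    · have : k - 1 ≠ k := by simp
      simp [e', this.symm]
    · refine congrArg List.ofFn (funext fun i => ?_)
      -- The offset lies between 1 and n, so modulo n + 2 it is neither 0 nor -1 and both updates
      -- are avoided.
      have hk : k + i.succ.castSucc ≠ k := by
        rw [Ne, add_eq_left]
        exact fun h => by simpa using congrArg Fin.val h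
      have hk' : k + i.succ.castSucc ≠ k - 1 := by
        rw [Ne, sub_eq_add_neg, add_right_inj, ← hneg]
        exact fun h => by
          have := congrArg Fin.val h
          simp at this
          omega
      simp only [e', Function.update_of_ne hk, Function.update_of_ne hk']
      rw [add_assoc, Fin.one_add_castSucc_castSucc]
  rw [h1, List.ofFn_succ_last]
  have h2 : k + (Fin.last n).castSucc = k - 1 - 1 := by
    rw [eq_sub_iff_add_eq, add_assoc, hlast, hneg, sub_eq_add_neg]
  rw [h2]
  simp [cyclicWord]

/-- The endmarkers are at their places. -/
def Config.WellFormed (c : M.Config n) : Prop :=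
  c.tape 0 = .leftEnd ∧ c.tape (Fin.last (n + 1)) = .rightEnd

theorem Config.WellFormed.step {c c' : M.Config n} (h : c.WellFormed) (hs : M.Step c c') :
    c'.WellFormed := by
  obtain ⟨d, m, ht, -, hc⟩ := hs
  constructor
  · rw [hc, Function.update_apply]
    split_ifs with h0
    · rw [← h0, h.1] at ht
      exact (M.trans_leftEnd _ _ _ _ ht).1
    · exact h.1
  · rw [hc, Function.update_apply]
    split_ifs with h0
    · rw [← h0, h.2] at ht
      exact (M.trans_rightEnd _ _ _ _ ht).1
    · exact h.2

/-- Every rewriting of a window is a step of the machine. -/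
theorem WindowStep.exists_config {c : M.Config n} (hc : c.WellFormed) {k : Fin (n + 2)}
    {x y : M.MarkedCell} (h : M.WindowStep (c.marked k) (c.marked (k - 1)) x y) :
    ∃ c' : M.Config n, Relation.ReflTransGen M.Step c c' ∧ c'.WellFormed ∧
      c'.marked = Function.update (Function.update c.marked k x) (k - 1) y := by
  have hk : k - 1 ≠ k := by simp
  generalize ha : c.marked k = a at h
  generalize hb : c.marked (k - 1) = b at h
  cases h with
  | stay =>
    refine ⟨c, .refl, hc, ?_⟩
    rw [← ha, ← hb, Function.update_eq_self, Function.update_eq_self]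
  | @left p q u d e ht =>
    simp only [Config.marked, Prod.mk.injEq, Option.ite_none_right_eq_some,
      Option.some.injEq] at ha hb
    obtain ⟨rfl, hhead, rfl⟩ := ha
    -- For k = 0 the window joins the two ends of the tape; the endmarker rules exclude a move
    -- across this seam.
    have h0 : k ≠ 0 := by
      rintro rfl
      rw [hc.1] at ht
      exact HeadMove.noConfusion (M.trans_leftEnd _ _ _ _ ht).2
    have hs : M.Step c ⟨q, k - 1, Function.update c.tape k d⟩ := by
      refine ⟨d, .left, by rwa [← hhead], ?_, by rw [hhead]⟩
      have : (k : ℕ) ≠ 0 := fun h => h0 (Fin.ext h)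
      rw [← hhead]
      simp only [Moves, Fin.val_sub_one_of_ne_zero h0]
      omega
    refine ⟨_, .single hs, hc.step hs, ?_⟩
    funext i
    by_cases h1 : i = k - 1
    · subst h1
      simp [Config.marked, hb.1]
    · by_cases h2 : i = k
      · subst h2
        simp [Config.marked, hk.symm]
      · simp [Config.marked, h1, h2, ← hhead]
  | @right p q u d e ht =>
    simp only [Config.marked, Prod.mk.injEq, Option.ite_none_right_eq_some,
      Option.some.injEq] at ha hb
    obtain ⟨rfl, hhead, rfl⟩ := hb
    have h0 : k ≠ 0 := by
      rintro rfl
      have : (0 - 1 : Fin (n + 2)) = Fin.last (n + 1) := by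
        rw [sub_eq_iff_eq_add, Fin.last_add_one]
      rw [this, hc.2] at ht
      exact HeadMove.noConfusion (M.trans_rightEnd _ _ _ _ ht).2
    have hs : M.Step c ⟨q, k, Function.update c.tape (k - 1) d⟩ := by
      refine ⟨d, .right, by rwa [← hhead], ?_, by rw [hhead]⟩
      have : (k : ℕ) ≠ 0 := fun h => h0 (Fin.ext h)
      rw [← hhead]
      simp only [Moves, Fin.val_sub_one_of_ne_zero h0]
      omega
    refine ⟨_, .single hs, hc.step hs, ?_⟩
    funext i
    by_cases h1 : i = k - 1
    · subst h1
      simp [Config.marked]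
    · by_cases h2 : i = k
      · subst h2
        simp [Config.marked, ha.1, hk.symm]
      · simp [Config.marked, h1, h2, ← hhead]

/-- Every step of the machine is a rewriting of some window. -/
theorem Step.exists_windowStep {c c' : M.Config n} (h : M.Step c c') :
    ∃ k x y, M.WindowStep (c.marked k) (c.marked (k - 1)) x y ∧
      c'.marked = Function.update (Function.update c.marked k x) (k - 1) y := by
  obtain ⟨p, k, t⟩ := c
  obtain ⟨q, l, t'⟩ := c'
  obtain ⟨d, m, ht, hm, hc⟩ := h
  dsimp only at ht hm hc
  subst hc
  cases m with
  | left =>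
    obtain rfl : l = k - 1 := by
      have h0 : k ≠ 0 := by
        rintro rfl
        simp [Moves] at hm
      ext
      simp only [Moves] at hm
      rw [Fin.val_sub_one_of_ne_zero h0]
      omega
    refine ⟨k, (d, none), (t (k - 1), some q), ?_, ?_⟩
    · simpa [Config.marked] using WindowStep.left ht
    · funext i
      by_cases h1 : i = k - 1
      · subst h1
        simp [Config.marked]
      · by_cases h2 : i = k
        · subst h2
          simp [Config.marked, h1]
        · simp [Config.marked, h1, h2]
  | right =>
    obtain rfl : k = l - 1 := by
      have h0 : l ≠ 0 := by
        rintro rfl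
        simp [Moves] at hm
      ext
      simp only [Moves] at hm
      rw [Fin.val_sub_one_of_ne_zero h0]
      omega
    refine ⟨l, (t l, some q), (d, none), ?_, ?_⟩
    · have hl : l - 1 ≠ l := by simp
      simpa [Config.marked, hl.symm] using WindowStep.right ht
    · funext i
      by_cases h1 : i = l - 1
      · subst h1
        simp [Config.marked]
      · by_cases h2 : i = l
        · subst h2
          simp [Config.marked, h1]
        · simp [Config.marked, h1, h2]

/-! ### Simulation of the machine by window and queue -/

open RationalGraph in
/-- The window automaton, started in the position `k` of the cyclic tape `e` and fed back through a
queue, accepts a suitable word. -/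
def WindowAccepts (M : LinearlyBoundedMachine A) (e : Fin (n + 2) → M.MarkedCell)
    (k : Fin (n + 2)) : Prop :=
  ∃ v : List M.MarkedCell, delays (cyclicWord e k) (v.map fun x => (x, x)) ∈
    M.windowNFA.acceptsFrom {(e k, e (k - 1))}

/-- The guessed word is extended in front by x, the cell pushed in this round. -/
theorem WindowAccepts.of_windowStep {e : Fin (n + 2) → M.MarkedCell} {k : Fin (n + 2)}
    {x y : M.MarkedCell} (h : M.WindowStep (e k) (e (k - 1)) x y)
    (ha : M.WindowAccepts (Function.update (Function.update e k x) (k - 1) y) (k - 1)) :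
    M.WindowAccepts e k := by
  obtain ⟨v, hv⟩ := ha
  refine ⟨x :: v, ?_⟩
  rw [List.map_cons, RationalGraph.delays_cons _ (cons_cyclicWord e k x y),
    cons_mem_acceptsFrom_windowNFA]
  refine ⟨y, h, ?_⟩
  rwa [Function.update_self] at hv

/-- Rounds that change nothing rotate the window, and every position is reached from every other
one. -/
theorem WindowAccepts.all {e : Fin (n + 2) → M.MarkedCell} {k : Fin (n + 2)}
    (h : M.WindowAccepts e k) (l : Fin (n + 2)) : M.WindowAccepts e l := by
  have hstep : ∀ k, M.WindowAccepts e (k - 1) → M.WindowAccepts e k := fun k hk =>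
    .of_windowStep (.stay _ _) (by rwa [Function.update_eq_self, Function.update_eq_self])
  have hall : ∀ m : ℕ, M.WindowAccepts e (k + (Fin.ofNat (n + 2) m)) := by
    intro m
    induction m with
    | zero => simpa using h
    | succ m ih =>
      refine hstep _ ?_
      have : Fin.ofNat (n + 2) (m + 1) = Fin.ofNat (n + 2) m + 1 := by
        ext; simp [Fin.val_add]
      rwa [this, ← add_assoc, add_sub_cancel_right]
  have := hall (l - k).val
  rwa [show Fin.ofNat (n + 2) (l - k).val = l - k from Fin.ext (Nat.mod_eq_of_lt (l - k).isLt),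
    add_sub_cancel] at this

theorem windowAccepts_of_reaches {c c' : M.Config n} (h : Relation.ReflTransGen M.Step c c')
    (ha : c'.state ∈ M.accept) (k : Fin (n + 2)) : M.WindowAccepts c.marked k := by
  induction h using Relation.ReflTransGen.head_induction_on generalizing k with
  | refl =>
    -- The automaton looks for an accepting state in the first window cell only, so the window is
    -- placed with that cell under the head.
    refine WindowAccepts.all (k := c'.head) ⟨[], ?_⟩ k
    rw [List.map_nil, RationalGraph.delays_nil, NFA.nil_mem_acceptsFrom]
    exact ⟨_, rfl, _, ha, by simp [Config.marked]⟩
  | head hs _ ih =>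
    obtain ⟨l, x, y, hw, he⟩ := hs.exists_windowStep
    exact WindowAccepts.all (k := l) (.of_windowStep hw (he ▸ ih _)) k

theorem WindowAccepts.exists_reaches {c : M.Config n} {k : Fin (n + 2)} (hc : c.WellFormed)
    (h : M.WindowAccepts c.marked k) :
    ∃ c' : M.Config n, Relation.ReflTransGen M.Step c c' ∧ c'.state ∈ M.accept := by
  obtain ⟨v, hv⟩ := h
  induction v generalizing c k with
  | nil =>
    rw [List.map_nil, RationalGraph.delays_nil, NFA.nil_mem_acceptsFrom] at hv
    obtain ⟨_, rfl, q, hq, hs⟩ := hv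
    simp only [Config.marked, Option.ite_none_right_eq_some, Option.some.injEq] at hs
    exact ⟨c, .refl, hs.2 ▸ hq⟩
  | cons x v ih =>
    rw [List.map_cons] at hv
    -- Only some splitting is needed to pop a letter, so the second x is a dummy; once the actual y
    -- is known, `C` and z are identified by uniqueness of the splitting.
    obtain ⟨C, z, hC⟩ : ∃ C z, x :: cyclicWord c.marked k = C ++ [z] :=
      ⟨_, _, cons_cyclicWord c.marked k x x⟩
    rw [RationalGraph.delays_cons _ hC, cons_mem_acceptsFrom_windowNFA] at hv
    obtain ⟨y, hw, hv⟩ := hv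
    obtain ⟨c', hs, hc', he⟩ := hw.exists_config hc
    have hC' := (hC.symm.trans (cons_cyclicWord c.marked k x y))
    rw [← he] at hC'
    obtain ⟨rfl, hz⟩ := List.append_inj' hC' rfl
    obtain rfl : z = _ := by simpa using hz
    have hy : y = c'.marked (k - 1) := by rw [he, Function.update_self]
    rw [hy] at hv
    obtain ⟨c'', hs', ha⟩ := ih hc' hv
    exact ⟨c'', hs.trans hs', ha⟩

theorem wellFormed_init (M : LinearlyBoundedMachine A) (w : List A) : (M.init w).WellFormed := by
  simp [Config.WellFormed, init, initTape]

/-- At position 0 the window covers exactly the two endmarkers, which leaves the input in the queue.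
-/
theorem cyclicWord_init (M : LinearlyBoundedMachine A) (w : List A) :
    cyclicWord (M.init w).marked 0 = w.map fun a => (.sym (M.input a), none) := by
  refine List.ext_getElem (by simp [cyclicWord]) fun i h h' => ?_
  have hi : i < w.length := by simpa using h'
  have h1 : (0 + 1 + (⟨i, hi⟩ : Fin w.length).castSucc.castSucc : Fin (w.length + 2)) =
      (⟨i, hi⟩ : Fin w.length).succ.castSucc := by
    rw [zero_add, Fin.one_add_castSucc_castSucc]
  simp only [cyclicWord, List.getElem_ofFn, List.getElem_map, Config.marked]
  rw [h1]
  simp [init, initTape, hi, Fin.ext_iff]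

theorem mem_language_iff_windowAccepts (M : LinearlyBoundedMachine A) (w : List A) :
    w ∈ M.language ↔ M.WindowAccepts (M.init w).marked 0 :=
  ⟨fun ⟨_, hs, ha⟩ => windowAccepts_of_reaches hs ha 0,
    fun h => h.exists_reaches (M.wellFormed_init w)⟩

/-- The path language of a graph of delays between the words with two equal components and the
words accepted by the window automaton is the language of the machine. -/
theorem pathLanguage_delayGraph (M : LinearlyBoundedMachine A) :
    (RationalGraph.delayGraph M.MarkedCell
      fun a => ((.sym (M.input a), none) : M.MarkedCell)).pathLanguage
      (NFA.diagonal M.MarkedCell).accepts M.windowNFA.accepts = M.language := by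
  ext w
  have hl : (0 - 1 : Fin (w.length + 2)) = Fin.last (w.length + 1) := by
    rw [sub_eq_iff_eq_add, Fin.last_add_one]
  have hstart : M.windowNFA.start = {((M.init w).marked 0, (M.init w).marked (0 - 1))} := by
    rw [hl]
    simp [windowNFA, Config.marked, init, initTape]
  rw [mem_language_iff_windowAccepts, WindowAccepts, cyclicWord_init, ← hstart]
  constructor
  · rintro ⟨s, hs, t, ht, hp⟩
    obtain ⟨-, v, rfl⟩ := NFA.mem_acceptsFrom_diagonal.1 hs
    rw [RationalGraph.path_delayGraph] at hp
    exact ⟨v, hp ▸ ht⟩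
  · rintro ⟨v, hv⟩
    exact ⟨_, NFA.mem_acceptsFrom_diagonal.2 ⟨⟨(), trivial⟩, v, rfl⟩, _, hv,
      RationalGraph.path_delayGraph.2 rfl⟩

end LinearlyBoundedMachine

/-! ### Rows and columns of a path in a synchronous graph -/

namespace RationalGraph

variable {A Γ : Type} (G : RationalGraph A Γ)

/-- A label together with a state of its transducer. -/
abbrev LabelledState : Type := Σ a, (G.transducer a).State

/-- The label `a` together with the initial state of its transducer. -/
def startState (a : A) : G.LabelledState := ⟨a, (G.transducer a).start⟩

/-- `G.Cascade l u v`: the transducers of the list `l`, started in the given states and applied one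
after the other, may transform `u` into `v`. -/
inductive Cascade : List G.LabelledState → List Γ → List Γ → Prop
  | nil (u) : Cascade [] u u
  | cons {a p q l u r v} : (G.transducer a).Run p u r q → q ∈ (G.transducer a).accept →
      Cascade l r v → Cascade (⟨a, p⟩ :: l) u v

/-- `G.Column l x z l'`: one transition for each transducer of the list `l`, where the first one
reads `x`, every other one reads the letter written by the previous one, and the last one writes
`z`, leads to the states in `l'`. -/
inductive Column : List G.LabelledState → Γ → Γ → List G.LabelledState → Prop
  | nil (x) : Column [] x x []
  | cons {a p q l x y z l'} : (G.transducer a).trans p (some x) (some y) q →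
      Column l y z l' → Column (⟨a, p⟩ :: l) x z (⟨a, q⟩ :: l')

variable {G}

theorem path_iff_cascade {w : List A} {s t : List Γ} :
    G.Path s w t ↔ G.Cascade (w.map G.startState) s t := by
  constructor
  · intro h
    induction h with
    | nil s => exact .nil s
    | cons he _ ih =>
      obtain ⟨q, hq, hr⟩ := he
      exact .cons hr hq ih
  · intro h
    induction w generalizing s with
    | nil =>
      cases h
      exact .nil _
    | cons a w ih =>
      obtain _ | ⟨hr, hq, h'⟩ := h
      exact .cons ⟨_, hq, hr⟩ (ih h')

theorem _root_.Transducer.IsSynchronous.of_run_nil {T : Transducer Γ} (hT : T.IsSynchronous)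
    {p q : T.State} {v : List Γ} (h : T.Run p [] v q) : v = [] ∧ p = q := by
  generalize hu : ([] : List Γ) = u at h
  cases h with
  | nil => exact ⟨rfl, rfl⟩
  | cons ht _ =>
    obtain ⟨x, rfl⟩ := Option.ne_none_iff_exists'.1 (hT _ _ _ _ ht).1
    simp at hu

theorem _root_.Transducer.IsSynchronous.of_run_cons {T : Transducer Γ} (hT : T.IsSynchronous)
    {p q : T.State} {x : Γ} {u v : List Γ} (h : T.Run p (x :: u) v q) :
    ∃ y v' r, T.trans p (some x) (some y) r ∧ T.Run r u v' q ∧ v = y :: v' := by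
  generalize hu : x :: u = u' at h
  cases h with
  | nil => simp at hu
  | cons ht hr =>
    obtain ⟨h1, h2⟩ := hT _ _ _ _ ht
    obtain ⟨x, rfl⟩ := Option.ne_none_iff_exists'.1 h1
    obtain ⟨y, rfl⟩ := Option.ne_none_iff_exists'.1 h2
    simp only [Option.toList_some, List.singleton_append, List.cons.injEq] at hu
    obtain ⟨rfl, rfl⟩ := hu
    exact ⟨y, _, _, ht, hr, rfl⟩

theorem cascade_nil_iff (hG : G.IsSynchronous) {l : List G.LabelledState} {v : List Γ} :
    G.Cascade l [] v ↔ v = [] ∧ ∀ s ∈ l, s.2 ∈ (G.transducer s.1).accept := by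
  induction l with
  | nil =>
    constructor
    · rintro ⟨⟩
      simp
    · rintro ⟨rfl, -⟩
      exact .nil _
  | cons s l ih =>
    constructor
    · rintro (_ | ⟨hr, hq, h⟩)
      obtain ⟨rfl, rfl⟩ := (hG _).of_run_nil hr
      obtain ⟨rfl, h'⟩ := ih.1 h
      exact ⟨rfl, List.forall_mem_cons.2 ⟨hq, h'⟩⟩
    · rintro ⟨rfl, h⟩
      rw [List.forall_mem_cons] at h
      exact .cons (.nil _) h.1 (ih.2 ⟨rfl, h.2⟩)

/-- By synchrony each transducer reads and writes exactly one letter per transition, so the first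
transitions of all the runs fit together into a column. -/
theorem Cascade.exists_column (hG : G.IsSynchronous) {l : List G.LabelledState} {x : Γ}
    {u v : List Γ} (h : G.Cascade l (x :: u) v) :
    ∃ z l' v', G.Column l x z l' ∧ G.Cascade l' u v' ∧ v = z :: v' := by
  induction l generalizing x u with
  | nil =>
    cases h
    exact ⟨x, [], u, .nil x, .nil u, rfl⟩
  | cons s l ih =>
    obtain _ | ⟨hr, hq, h⟩ := h
    obtain ⟨y, r, p, ht, hr', rfl⟩ := (hG _).of_run_cons hr
    obtain ⟨z, l', v', hc, hl, rfl⟩ := ih h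
    exact ⟨z, _, v', .cons ht hc, .cons hr' hq hl, rfl⟩

theorem Column.cascade {l l' : List G.LabelledState} {x z : Γ} {u v : List Γ}
    (hc : G.Column l x z l') (h : G.Cascade l' u v) : G.Cascade l (x :: u) (z :: v) := by
  induction hc generalizing u with
  | nil x =>
    cases h
    exact .nil _
  | @cons a p q l x y z l' ht _ ih =>
    obtain _ | ⟨hr, hq, h⟩ := h
    exact .cons (.cons (x := some x) (y := some y) ht hr) hq (ih h)

theorem Column.length_eq {l l' : List G.LabelledState} {x z : Γ} (h : G.Column l x z l') :
    l'.length = l.length := by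
  induction h with
  | nil => rfl
  | cons _ _ ih => simp [ih]

/-! ### The sweeping machine -/

variable (G) {σ τ : Type} (D : DFA Γ σ) (E : DFA Γ τ)

/-- The states of the linearly bounded machine `G.sweeper D E`. -/
inductive SweepState (Γ σ τ : Type) : Type where
  | back : σ → τ → SweepState Γ σ τ
  | sweep : σ → τ → Γ → SweepState Γ σ τ
  | check : SweepState Γ σ τ
  | done : SweepState Γ σ τ

instance [Finite Γ] [Finite σ] [Finite τ] : Finite (SweepState Γ σ τ) := by
  refine Finite.of_injective (β := (σ × τ) ⊕ (σ × τ × Γ) ⊕ Bool)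
    (fun | .back i f => .inl (i, f) | .sweep i f x => .inr (.inl (i, f, x))
         | .check => .inr (.inr true) | .done => .inr (.inr false)) ?_
  rintro (⟨_, _⟩ | ⟨_, _, _⟩ | _ | _) (⟨_, _⟩ | ⟨_, _, _⟩ | _ | _) <;> simp

/-- The transitions of the linearly bounded machine `G.sweeper D E`. -/
inductive SweepTrans : SweepState Γ σ τ → TapeCell G.LabelledState → SweepState Γ σ τ →
    TapeCell G.LabelledState → HeadMove → Prop
  | guess (i f x) : SweepTrans (.back i f) .leftEnd (.sweep (D.step i x) f x) .leftEnd .right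
  | sweep (i f) {x a p y q} : (G.transducer a).trans p (some x) (some y) q →
      SweepTrans (.sweep i f x) (.sym ⟨a, p⟩) (.sweep i f y) (.sym ⟨a, q⟩) .right
  | turn (i f x) : SweepTrans (.sweep i f x) .rightEnd (.back i (E.step f x)) .rightEnd .left
  | back (i f s) : SweepTrans (.back i f) (.sym s) (.back i f) (.sym s) .left
  | check {i f} : i ∈ D.accept → f ∈ E.accept → SweepTrans (.back i f) .leftEnd .check .leftEnd .right
  | checkSym {a p} : p ∈ (G.transducer a).accept →
      SweepTrans .check (.sym ⟨a, p⟩) .check (.sym ⟨a, p⟩) .right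
  | finish : SweepTrans .check .rightEnd .done .rightEnd .left

/-- A linearly bounded machine that stores the states of the transducers of a path in its cells and
guesses the vertices of the path letter by letter. -/
def sweeper [Finite A] [Finite Γ] [Finite σ] [Finite τ] : LinearlyBoundedMachine A where
  State := SweepState Γ σ τ
  finite_state := inferInstance
  Symbol := G.LabelledState
  finite_symbol := by
    have := fun a => (G.transducer a).finite_state
    infer_instance
  input := ⟨G.startState, fun _ _ h => congrArg Sigma.fst h⟩
  start := .back D.start E.start
  accept := {.done}
  trans := G.SweepTrans D E
  trans_leftEnd := by rintro _ _ _ _ ⟨⟩ <;> exact ⟨rfl, rfl⟩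
  trans_rightEnd := by rintro _ _ _ _ ⟨⟩ <;> exact ⟨rfl, rfl⟩
  trans_sym := by rintro _ _ _ _ _ ⟨⟩ <;> exact ⟨_, rfl⟩

end RationalGraph

/-! ### Steps on a tape given by a word -/

namespace LinearlyBoundedMachine

variable {A : Type} {M : LinearlyBoundedMachine A} {n : ℕ}

/-- The tape with the word `l` between the endmarkers. -/
def tapeOf {S : Type} {n : ℕ} (l : List S) (i : Fin (n + 2)) : TapeCell S :=
  if i.val = 0 then .leftEnd else (l[i.val - 1]?).elim .rightEnd .sym

theorem tapeOf_zero {S : Type} (l : List S) : tapeOf l (0 : Fin (n + 2)) = .leftEnd := rfl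

theorem tapeOf_of_eq_length_add_one {S : Type} {l : List S} {k : Fin (n + 2)}
    (h : k.val = l.length + 1) : tapeOf l k = .rightEnd := by
  simp [tapeOf, h]

theorem tapeOf_append_cons {S : Type} {l₁ l₂ : List S} {s : S} {k : Fin (n + 2)}
    (h : k.val = l₁.length + 1) : tapeOf (l₁ ++ s :: l₂) k = .sym s := by
  simp [tapeOf, h]

theorem update_tapeOf {S : Type} {l₁ l₂ : List S} {s t : S} {k : Fin (n + 2)}
    (h : k.val = l₁.length + 1) :
    Function.update (tapeOf (l₁ ++ s :: l₂)) k (.sym t) = tapeOf (l₁ ++ t :: l₂) := by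
  funext i
  rw [Function.update_apply]
  split_ifs with hi
  · rw [hi, tapeOf_append_cons h]
  · have hik : i.val ≠ l₁.length + 1 := fun h' => hi (Fin.ext (h'.trans h.symm))
    unfold tapeOf
    split_ifs with h0
    · rfl
    · congr 1
      rw [List.getElem?_append, List.getElem?_append]
      split_ifs with h1
      · rfl
      · obtain ⟨m, hm⟩ : ∃ m, i.val - 1 - l₁.length = m + 1 :=
          Nat.exists_eq_succ_of_ne_zero (by omega)
        simp [hm]

theorem initTape_eq_tapeOf (M : LinearlyBoundedMachine A) (w : List A) :
    M.initTape w = tapeOf (w.map M.input) := by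
  funext i
  unfold initTape tapeOf
  split_ifs with h0 h1
  · rfl
  · simp [h1]
  · simp [List.getElem?_eq_none (not_lt.1 h1)]

/-- The possible forms of a step on the word `l` between the endmarkers. -/
theorem Step.cases_tapeOf {c c' : M.Config n} (h : M.Step c c') {l : List M.Symbol}
    (hl : l.length = n) (ht : c.tape = tapeOf l) :
    (M.trans c.state .leftEnd c'.state .leftEnd .right ∧ c'.head.val = 1 ∧ c'.tape = tapeOf l) ∨
    (∃ l₁ s l₂ t m, l = l₁ ++ s :: l₂ ∧ c.head.val = l₁.length + 1 ∧
      M.trans c.state (.sym s) c'.state (.sym t) m ∧ Moves c.head m c'.head ∧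
      c'.tape = tapeOf (l₁ ++ t :: l₂)) ∨
    (c.head.val = n + 1 ∧ M.trans c.state .rightEnd c'.state .rightEnd .left ∧
      c'.tape = tapeOf l) := by
  obtain ⟨d, m, htr, hm, hc⟩ := h
  rw [ht] at htr hc
  rcases Nat.eq_zero_or_pos c.head.val with h0 | h0
  · have h0' : c.head = 0 := Fin.ext h0
    rw [h0', tapeOf_zero] at htr
    obtain ⟨rfl, rfl⟩ := M.trans_leftEnd _ _ _ _ htr
    refine .inl ⟨htr, by simpa [Moves, h0] using hm, ?_⟩
    rw [hc, h0', ← tapeOf_zero (n := n) l, Function.update_eq_self]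
  · by_cases h1 : c.head.val = n + 1
    · have he := tapeOf_of_eq_length_add_one (l := l) (h1.trans (congrArg (· + 1) hl.symm))
      rw [he] at htr
      obtain ⟨rfl, rfl⟩ := M.trans_rightEnd _ _ _ _ htr
      refine .inr (.inr ⟨h1, htr, ?_⟩)
      rw [hc, ← he, Function.update_eq_self]
    · have hlt := c.head.isLt
      have hk : c.head.val - 1 < l.length := by omega
      have hlen : c.head.val = (l.take (c.head.val - 1)).length + 1 := by
        rw [List.length_take]; omega
      have hsplit : l = l.take (c.head.val - 1) ++ l[c.head.val - 1] :: l.drop (c.head.val - 1 + 1) := by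
        rw [List.getElem_cons_drop, List.take_append_drop]
      rw [hsplit] at htr hc
      rw [tapeOf_append_cons hlen] at htr
      obtain ⟨t, rfl⟩ := M.trans_sym _ _ _ _ _ htr
      rw [update_tapeOf hlen] at hc
      exact .inr (.inl ⟨_, _, _, t, m, hsplit, hlen, htr, hm, hc⟩)

theorem step_leftEnd {p q : M.State} {l : List M.Symbol}
    (h : M.trans p .leftEnd q .leftEnd .right) :
    M.Step (n := n) ⟨p, 0, tapeOf l⟩ ⟨q, 1, tapeOf l⟩ :=
  ⟨.leftEnd, .right, h, by simp [Moves], by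
    dsimp only
    rw [← tapeOf_zero (n := n) l, Function.update_eq_self]⟩

theorem step_rightEnd {p q : M.State} {l : List M.Symbol} {j k : Fin (n + 2)}
    (hj : j.val = l.length + 1) (hk : k.val = l.length)
    (h : M.trans p .rightEnd q .rightEnd .left) :
    M.Step (n := n) ⟨p, j, tapeOf l⟩ ⟨q, k, tapeOf l⟩ :=
  ⟨.rightEnd, .left, (tapeOf_of_eq_length_add_one hj).symm ▸ h, by simp [Moves, hj, hk], by
    dsimp only
    rw [← tapeOf_of_eq_length_add_one hj, Function.update_eq_self]⟩

theorem step_sym {p q : M.State} {l₁ l₂ : List M.Symbol} {s t : M.Symbol} {m : HeadMove}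
    {j k : Fin (n + 2)} (hj : j.val = l₁.length + 1) (hk : Moves j m k)
    (h : M.trans p (.sym s) q (.sym t) m) :
    M.Step (n := n) ⟨p, j, tapeOf (l₁ ++ s :: l₂)⟩ ⟨q, k, tapeOf (l₁ ++ t :: l₂)⟩ :=
  ⟨.sym t, m, by dsimp only; rwa [tapeOf_append_cons hj], hk, (update_tapeOf hj).symm⟩

end LinearlyBoundedMachine

/-! ### Correctness of the sweeping machine -/

namespace RationalGraph

open LinearlyBoundedMachine

variable {A Γ σ τ : Type} [Finite A] [Finite Γ] [Finite σ] [Finite τ] {G : RationalGraph A Γ}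
  {D : DFA Γ σ} {E : DFA Γ τ} {n : ℕ}

/-- What the acceptance by `G.sweeper D E` from the state `p`, where the head is preceded by `l₁` and
followed by `l₂`, says about the graph. -/
def SweepInvariant (G : RationalGraph A Γ) (D : DFA Γ σ) (E : DFA Γ τ)
    (l₁ l₂ : List G.LabelledState) : SweepState Γ σ τ → Prop
  | .back i f => ∃ u v, G.Cascade (l₁ ++ l₂) u v ∧ u ∈ D.acceptsFrom i ∧ v ∈ E.acceptsFrom f
  | .sweep i f x => ∃ z l' u v, G.Column l₂ x z l' ∧ G.Cascade (l₁ ++ l') u v ∧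
      u ∈ D.acceptsFrom i ∧ v ∈ E.acceptsFrom (E.step f z)
  | .check => ∀ s ∈ l₂, s.2 ∈ (G.transducer s.1).accept
  | .done => True

theorem sweeper_step_cases {c c' : (G.sweeper D E).Config n} (h : (G.sweeper D E).Step c c')
    {l : List G.LabelledState} (hl : l.length = n) (ht : c.tape = tapeOf l) :
    (G.SweepTrans D E c.state .leftEnd c'.state .leftEnd .right ∧ c'.head.val = 1 ∧
      c'.tape = tapeOf l) ∨
    (∃ (l₁ : List G.LabelledState) (s : G.LabelledState) (l₂ : List G.LabelledState)
      (t : G.LabelledState) (m : HeadMove), l = l₁ ++ s :: l₂ ∧ c.head.val = l₁.length + 1 ∧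
      G.SweepTrans D E c.state (.sym s) c'.state (.sym t) m ∧ Moves c.head m c'.head ∧
      c'.tape = tapeOf (l₁ ++ t :: l₂)) ∨
    (c.head.val = n + 1 ∧ G.SweepTrans D E c.state .rightEnd c'.state .rightEnd .left ∧
      c'.tape = tapeOf l) :=
  h.cases_tapeOf hl ht

/-- Induction backwards from the accepting configuration: the words in the invariant are the
suffixes still to be guessed and produced. Truncated subtraction makes head positions 0 and 1 split
the tape alike, with nothing before the head. -/
theorem sweepInvariant_of_reaches (hG : G.IsSynchronous) {c c' : (G.sweeper D E).Config n}
    (h : Relation.ReflTransGen (G.sweeper D E).Step c c') (ha : c'.state ∈ (G.sweeper D E).accept)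
    {l : List G.LabelledState} (hl : l.length = n) (ht : c.tape = tapeOf l) :
    SweepInvariant G D E (l.take (c.head.val - 1)) (l.drop (c.head.val - 1)) c.state := by
  induction h using Relation.ReflTransGen.head_induction_on generalizing l with
  | refl =>
    have hd : c'.state = .done := ha
    rw [hd]
    trivial
  | @head c c₁ hs _ ih =>
    obtain ⟨htr, hh, ht'⟩ | ⟨l₁, s, l₂, t, m, rfl, hh, htr, hm, ht'⟩ | ⟨hh, htr, ht'⟩ :=
      sweeper_step_cases hs hl ht
    · have := ih hl ht'
      rw [hh] at this
      generalize c.state = p at htr ⊢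
      generalize c₁.state = p' at htr this
      cases htr with
      | guess i f x =>
        obtain ⟨z, l', u, v, hc, hcas, hu, hv⟩ := this
        -- The guessed letter and the output of the sweep it starts are put in front of the
        -- remaining suffixes.
        refine ⟨x :: u, z :: v, ?_, hu, hv⟩
        rw [List.take_append_drop]
        exact hc.cascade hcas
      | check hi hf =>
        refine ⟨[], [], ?_, hi, hf⟩
        rw [List.take_append_drop]
        exact (cascade_nil_iff hG).2 ⟨rfl, this⟩
    · have := ih (l := l₁ ++ t :: l₂) (by simpa using hl) ht'
      have e1 : (l₁ ++ s :: l₂).take (c.head.val - 1) = l₁ := by simp [hh]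
      have e2 : (l₁ ++ s :: l₂).drop (c.head.val - 1) = s :: l₂ := by simp [hh]
      have e3 : m = .right → c₁.head.val - 1 = (l₁ ++ [t]).length := by
        rintro rfl
        simp only [Moves] at hm
        simp [hm, hh]
      have e4 : m = .right → (l₁ ++ t :: l₂).take (c₁.head.val - 1) = l₁ ++ [t] := fun hm => by
        rw [e3 hm, List.append_cons l₁ t l₂, List.take_left]
      have e5 : m = .right → (l₁ ++ t :: l₂).drop (c₁.head.val - 1) = l₂ := fun hm => by
        rw [e3 hm, List.append_cons l₁ t l₂, List.drop_left]
      rw [e1, e2]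
      generalize c.state = p at htr ⊢
      generalize c₁.state = p' at htr this
      cases htr with
      | sweep i f htr =>
        rw [e4 rfl, e5 rfl] at this
        obtain ⟨z, l', u, v, hc, hcas, hu, hv⟩ := this
        exact ⟨z, _, u, v, .cons htr hc, by rwa [List.append_cons], hu, hv⟩
      | back i f s =>
        obtain ⟨u, v, hcas, hu, hv⟩ := this
        rw [List.take_append_drop] at hcas
        exact ⟨u, v, hcas, hu, hv⟩
      | checkSym hp =>
        rw [e4 rfl, e5 rfl] at this
        exact List.forall_mem_cons.2 ⟨hp, this⟩
    · have := ih hl ht'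
      have e1 : l.take (c.head.val - 1) = l := by simp [hh, ← hl]
      have e2 : l.drop (c.head.val - 1) = [] := by simp [hh, ← hl]
      rw [e1, e2]
      generalize c.state = p at htr ⊢
      generalize c₁.state = p' at htr this
      cases htr with
      | turn i f x =>
        obtain ⟨u, v, hcas, hu, hv⟩ := this
        rw [List.take_append_drop] at hcas
        exact ⟨x, [], u, v, .nil x, by simpa using hcas, hu, hv⟩
      | finish =>
        intro s hs
        cases hs

/-- The configuration of `G.sweeper D E` with the given state, head position and tape content. -/
def sweepConfig (G : RationalGraph A Γ) (D : DFA Γ σ) (E : DFA Γ τ) {n : ℕ}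
    (p : SweepState Γ σ τ) (k : Fin (n + 2)) (l : List G.LabelledState) :
    (G.sweeper D E).Config n where
  state := p
  head := k
  tape := tapeOf l

theorem sweepConfig_step_sym {p q : SweepState Γ σ τ} {l₁ l₂ : List G.LabelledState}
    {s t : G.LabelledState} {m : HeadMove} {j k : Fin (n + 2)} (hj : j.val = l₁.length + 1)
    (hk : Moves j m k) (h : G.SweepTrans D E p (.sym s) q (.sym t) m) :
    (G.sweeper D E).Step (sweepConfig G D E p j (l₁ ++ s :: l₂))
      (sweepConfig G D E q k (l₁ ++ t :: l₂)) :=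
  step_sym (M := G.sweeper D E) hj hk h

theorem reaches_back (l : List G.LabelledState) (i : σ) (f : τ) (k : Fin (n + 2))
    (hk : k.val ≤ l.length) :
    Relation.ReflTransGen (G.sweeper D E).Step (sweepConfig G D E (.back i f) k l)
      (sweepConfig G D E (.back i f) 0 l) := by
  obtain ⟨k, hkn⟩ := k
  induction k with
  | zero => exact .refl
  | succ k ih =>
    have hk' : k < l.length := hk
    refine .head ?_ (ih (by omega) hk'.le)
    have hsplit : l = l.take k ++ l[k] :: l.drop (k + 1) := by
      rw [List.getElem_cons_drop, List.take_append_drop]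
    rw [hsplit]
    exact sweepConfig_step_sym (by simp [hk'.le]) (by simp [Moves]) (.back i f _)

/-- The rest of one sweep: the cells in `l₁` are already updated, those in `l` follow, and the head
then returns to the left endmarker. -/
theorem Column.reaches {l l' l₁ : List G.LabelledState} {x z : Γ} (h : G.Column l x z l')
    (hl : (l₁ ++ l).length = n) (i : σ) (f : τ) (k : Fin (n + 2)) (hk : k.val = l₁.length + 1) :
    Relation.ReflTransGen (G.sweeper D E).Step (sweepConfig G D E (.sweep i f x) k (l₁ ++ l))
      (sweepConfig G D E (.back i (E.step f z)) 0 (l₁ ++ l')) := by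
  induction h generalizing l₁ k with
  | nil x =>
    rw [List.append_nil] at hl ⊢
    refine .head ?_ (reaches_back l₁ i (E.step f x) ⟨l₁.length, by omega⟩ le_rfl)
    exact step_rightEnd (M := G.sweeper D E) hk rfl (.turn i f x)
  | @cons a p q l x y z l' ht hc ih =>
    have hlen : l₁.length + (l.length + 1) = n := by simpa using hl
    have := ih (l₁ := l₁ ++ [⟨a, q⟩]) (by simpa [add_assoc, add_comm 1] using hl)
      ⟨l₁.length + 2, by omega⟩ (by simp)
    rw [← List.append_cons, ← List.append_cons] at this
    exact .head (sweepConfig_step_sym hk (by simp [Moves, hk]) (.sweep i f ht)) this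

theorem reaches_done {l₁ l₂ : List G.LabelledState} (hl : (l₁ ++ l₂).length = n)
    (h : ∀ s ∈ l₂, s.2 ∈ (G.transducer s.1).accept) (k : Fin (n + 2))
    (hk : k.val = l₁.length + 1) :
    ∃ c : (G.sweeper D E).Config n, Relation.ReflTransGen (G.sweeper D E).Step
      (sweepConfig G D E .check k (l₁ ++ l₂)) c ∧ c.state ∈ (G.sweeper D E).accept := by
  induction l₂ generalizing l₁ k with
  | nil =>
    rw [List.append_nil] at hl ⊢
    refine ⟨sweepConfig G D E .done ⟨l₁.length, by omega⟩ l₁, .single ?_, rfl⟩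
    exact step_rightEnd (M := G.sweeper D E) hk rfl .finish
  | cons s l₂ ih =>
    rw [List.forall_mem_cons] at h
    have hlen : l₁.length + (l₂.length + 1) = n := by simpa using hl
    obtain ⟨c, hs, hc⟩ := ih (l₁ := l₁ ++ [s]) (by simpa [add_assoc, add_comm 1] using hl) h.2
      ⟨l₁.length + 2, by omega⟩ (by simp)
    rw [← List.append_cons] at hs
    exact ⟨c, .head (sweepConfig_step_sym hk (by simp [Moves, hk]) (.checkSym h.1)) hs, hc⟩

/-- One round trip per letter of u, and when u is exhausted a last pass verifying that all stored
states are accepting. -/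
theorem Cascade.reaches (hG : G.IsSynchronous) {l : List G.LabelledState} {u v : List Γ}
    (h : G.Cascade l u v) (hl : l.length = n) {i : σ} {f : τ} (hu : u ∈ D.acceptsFrom i)
    (hv : v ∈ E.acceptsFrom f) :
    ∃ c : (G.sweeper D E).Config n, Relation.ReflTransGen (G.sweeper D E).Step
      (sweepConfig G D E (.back i f) 0 l) c ∧ c.state ∈ (G.sweeper D E).accept := by
  induction u generalizing l v i f with
  | nil =>
    obtain ⟨rfl, hacc⟩ := (cascade_nil_iff hG).1 h
    obtain ⟨c, hs, hc⟩ := reaches_done (D := D) (E := E) (l₁ := []) hl hacc 1 (by simp)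
    exact ⟨c, .head (step_leftEnd (M := G.sweeper D E) (.check hu hv)) hs, hc⟩
  | cons x u ih =>
    obtain ⟨z, l', v, hcol, hcas, rfl⟩ := h.exists_column hG
    obtain ⟨c, hs, hc⟩ := ih hcas (hcol.length_eq.trans hl) (i := D.step i x)
      (f := E.step f z) hu hv
    refine ⟨c, .head (step_leftEnd (M := G.sweeper D E) (.guess i f x)) (.trans ?_ hs), hc⟩
    exact hcol.reaches (l₁ := []) hl _ _ 1 (by simp)

theorem language_sweeper (hG : G.IsSynchronous) :
    (G.sweeper D E).language = G.pathLanguage D.accepts E.accepts := by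
  ext w
  have hlen : (w.map G.startState).length = w.length := List.length_map _
  have ht : (G.sweeper D E).initTape w = tapeOf (w.map G.startState) :=
    initTape_eq_tapeOf (G.sweeper D E) w
  constructor
  · rintro ⟨c, hs, hc⟩
    obtain ⟨u, v, hcas, hu, hv⟩ := sweepInvariant_of_reaches hG hs hc hlen ht
    rw [List.take_append_drop] at hcas
    exact ⟨u, hu, v, hv, path_iff_cascade.2 hcas⟩
  · rintro ⟨u, hu, v, hv, hp⟩
    obtain ⟨c, hs, hc⟩ := (path_iff_cascade.1 hp).reaches hG hlen hu hv
    refine ⟨c, ?_, hc⟩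
    rw [init, ht]
    exact hs

end RationalGraph

theorem mainTheorem4 {A : Type} [Finite A] (L : Language A) :
    (∃ (Γ : Type) (_ : Finite Γ) (G : RationalGraph A Γ) (I F : Language Γ),
      G.IsSequential ∧ G.IsSynchronous ∧ I.IsRegular ∧ F.IsRegular ∧
        G.pathLanguage I F = L) ↔
      IsContextSensitive L := by
  constructor
  · rintro ⟨Γ, _, G, _, _, -, hG, ⟨σ, _, D, rfl⟩, ⟨τ, _, E, rfl⟩, rfl⟩
    exact ⟨G.sweeper D E, RationalGraph.language_sweeper hG⟩
  · rintro ⟨M, rfl⟩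
    exact ⟨M.MarkedCell × M.MarkedCell, inferInstance, _, _, _,
      RationalGraph.isSequential_delayGraph _, RationalGraph.isSynchronous_delayGraph _,
      NFA.isRegular_accepts _, NFA.isRegular_accepts _, M.pathLanguage_delayGraph⟩
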